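/- Trees are complete rooted planar binary trees; $L\wedge R$ is the tree with left subtree $L$ and right subtree $R$, and $\operatorname{ht}$ is the height (the one-leaf tree has height $0$). A tree is balanced if $\operatorname{ht}(R)-\operatorname{ht}(L)\in\{-1,0,1\}$ at each of its nodes, where $L$ and $R$ are the left and right subtrees of the node. A right rotation replaces a subtree $(A\wedge B)\wedge C$ of a tree by $A\wedge(B\wedge C)$, and the Tamari order $\preccurlyeq$ is the reflexive and transitive closure of right rotation. A balanced tree is maximal if every tree obtained from it by one right rotation is unbalanced, and minimal if every tree from which it is obtained by one right rotation is unbalanced. A maximal balanced tree interval is an interval $[T_0,T_1]$, with $T_0\preccurlyeq T_1$, such that $T_0$ is a minimal and $T_1$ a maximal balanced tree. Proposition. There is exactly one formal power series $A(x,y,z,t)\in\mathbb{Z}[[x,y,z,t]]$ with zero constant term such that $$A(x,y,z,t)=x+A\left(x^2+2yz+t,\;x,\;yz+t,\;x^3+x^2y\right).$$ It is the coefficientwise limit (each coefficient being eventually constant) of the polynomials $A_i$ given by $A_0=x$ and $A_{i+1}(x,y,z,t)=x+A_i(x^2+2yz+t,\,x,\,yz+t,\,x^3+x^2y)$. For every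 $n$ there are finitely many maximal balanced tree intervals $[T_0,T_1]$ whose trees have $n$ leaves, and the generating series of maximal balanced tree intervals according to the number $n$ of leaves of the trees is $A(x,0,0,0)$. -/

import Mathlib

namespace BalancedTamari

/-- Complete rooted planar binary trees; `nil` is the tree reduced to a leaf. The number of
leaves, the number of nodes and the height are `BinaryTree.numLeaves`, `BinaryTree.numNodes` and
`BinaryTree.height`. -/
abbrev BinTree : Type := BinaryTree Unit

/-- `L ∧ R`: the tree with left subtree `L` and right subtree `R`. -/
abbrev join (L R : BinTree) : BinTree := BinaryTree.node () L R

/-- At every node with left subtree `L` and right subtree `R`, the imbalance value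
`ht R - ht L` is `-1`, `0` or `1`. -/
def IsBalanced : BinTree → Prop
  | .nil => True
  | .node _ L R =>
      ((R.height : ℤ) - (L.height : ℤ) ∈ ({-1, 0, 1} : Set ℤ)) ∧ IsBalanced L ∧ IsBalanced R

/-- `Rotates T₀ T₁`: the tree `T₁` is obtained from `T₀` by one right rotation, that is, by
replacing a subtree `(A ∧ B) ∧ C` of `T₀` by `A ∧ (B ∧ C)`. -/
inductive Rotates : BinTree → BinTree → Prop
  | root (A B C : BinTree) : Rotates (join (join A B) C) (join A (join B C))
  | left {L L' : BinTree} (R : BinTree) : Rotates L L' → Rotates (join L R) (join L' R)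
  | right (L : BinTree) {R R' : BinTree} : Rotates R R' → Rotates (join L R) (join L R')

/-- The Tamari order: the reflexive and transitive closure of right rotation. -/
def TamariLE : BinTree → BinTree → Prop := Relation.ReflTransGen Rotates

/-- A balanced tree is minimal if every tree that rotates to it is unbalanced. -/
def IsMinimalBalanced (T : BinTree) : Prop :=
  IsBalanced T ∧ ∀ S : BinTree, Rotates S T → ¬ IsBalanced S

/-- A balanced tree is maximal if every tree to which it rotates is unbalanced. -/
def IsMaximalBalanced (T : BinTree) : Prop :=
  IsBalanced T ∧ ∀ S : BinTree, Rotates T S → ¬ IsBalanced S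

/-- The maximal balanced tree intervals `[T₀, T₁]` of the Tamari lattice of the trees with `n`
leaves, each given by its pair of ends. -/
def maximalBalancedIntervals (n : ℕ) : Set (BinTree × BinTree) :=
  {I | I.1.numLeaves = n ∧ I.2.numLeaves = n ∧ TamariLE I.1 I.2 ∧
    IsMinimalBalanced I.1 ∧ IsMaximalBalanced I.2}

/-- The generating series of maximal balanced tree intervals according to the number of leaves. -/
noncomputable def maximalIntervalSeries : PowerSeries ℤ :=
  PowerSeries.mk fun n => ((maximalBalancedIntervals n).ncard : ℤ)

/-- The polynomials `x² + 2yz + t`, `x`, `yz + t`, `x³ + x²y`, where `x`, `y`, `z`, `t` are the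
variables `X 0`, `X 1`, `X 2`, `X 3`. -/
noncomputable def growth : Fin 4 → MvPolynomial (Fin 4) ℤ :=
  open MvPolynomial in
  ![X 0 ^ 2 + 2 * X 1 * X 2 + X 3, X 0, X 1 * X 2 + X 3, X 0 ^ 3 + X 0 ^ 2 * X 1]

/-- A formal power series `A(x, y, z, t)` without constant term such that
`A(x, y, z, t) = x + A(x² + 2yz + t, x, yz + t, x³ + x²y)`. -/
def IsSolution (A : MvPowerSeries (Fin 4) ℤ) : Prop :=
  MvPowerSeries.constantCoeff A = 0 ∧
    A = MvPowerSeries.X 0 +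
      MvPowerSeries.subst (fun j => (growth j : MvPowerSeries (Fin 4) ℤ)) A

/-- The iterates `A₀ = x` and `Aᵢ₊₁ = x + Aᵢ(x² + 2yz + t, x, yz + t, x³ + x²y)`. -/
noncomputable def iterates : ℕ → MvPolynomial (Fin 4) ℤ
  | 0 => MvPolynomial.X 0
  | i + 1 => MvPolynomial.X 0 + MvPolynomial.bind₁ growth (iterates i)

/-- The univariate power series `A(x, 0, 0, 0)`. -/
noncomputable def restrictX (A : MvPowerSeries (Fin 4) ℤ) : PowerSeries ℤ :=
  MvPowerSeries.subst (![PowerSeries.X, 0, 0, 0] : Fin 4 → PowerSeries ℤ) A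

/-- The substitution in the functional equation is a legitimate one. -/
theorem hasSubst_growth :
    MvPowerSeries.HasSubst (fun j => (growth j : MvPowerSeries (Fin 4) ℤ)) := by
  refine MvPowerSeries.hasSubst_of_constantCoeff_zero fun j => ?_
  fin_cases j <;> simp [growth]

/-- The substitution `(x, 0, 0, 0)` is a legitimate one. -/
theorem hasSubst_restrictX :
    MvPowerSeries.HasSubst (![PowerSeries.X, 0, 0, 0] : Fin 4 → PowerSeries ℤ) := by
  refine MvPowerSeries.hasSubst_of_constantCoeff_zero fun j => ?_
  fin_cases j <;> simp [PowerSeries.X]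

end BalancedTamari

namespace BalancedTamari

/-! ### The Tamari order -/

/-! Combinatorics. Between balanced trees the Tamari order is very rigid: it coincides with
`ConsLE`, in which two trees are compared subtree by subtree, except that a root may undergo one
rotation `(A ∧ B) ∧ C → A ∧ (B ∧ C)` with `ht A = ht C` and `ht B ∈ {ht A, ht A - 1}`. In particular
the height is constant on comparable balanced trees (`TamariLE.consLE_of_numNodes_le`). Minimality
and maximality are local conditions at the nodes, so a maximal interval is a leaf, a graft of two
maximal intervals or a rotation of three (`IsMaxInterval.cases`).

Counting. At height `h`, let `x`, `y`, `z`, `t` be the series of the families `all`, `lower`,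
`rightTop`, `rot`. Passing to height `h + 1` replaces them by the four polynomials of `growth`
(`heightSeries_succ`), starting from `(x, 0, 0, 0)`. Hence `iterates i` at `(x, 0, 0, 0)` counts the
maximal intervals of height at most `i`.

Algebra. For the weights `(2, 1, 2, 3)` the substitution of `growth` raises the order of a series
without constant term by at least one. It is thus a contraction, which gives existence, uniqueness
and the convergence of the iterates. -/

theorem Rotates.numNodes_eq {S T : BinTree} (h : Rotates S T) : S.numNodes = T.numNodes := by
  induction h <;> simp only [BinaryTree.numNodes] <;> omega

theorem TamariLE.numNodes_eq {S T : BinTree} (h : TamariLE S T) : S.numNodes = T.numNodes := by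
  induction h with
  | refl => rfl
  | tail _ h ih => exact ih.trans h.numNodes_eq

theorem TamariLE.join {L L' R R' : BinTree} (hL : TamariLE L L') (hR : TamariLE R R') :
    TamariLE (BalancedTamari.join L R) (BalancedTamari.join L' R') :=
  (Relation.ReflTransGen.lift (fun L => BalancedTamari.join L R)
    (fun _ _ => Rotates.left R) _ _ hL).trans
    (Relation.ReflTransGen.lift (fun R => BalancedTamari.join L' R)
      (fun _ _ => Rotates.right L') _ _ hR)

/-- `Split T A E`: some node on the left spine of `T` has left subtree `A`, and `E` is what remains
of `T` to the right of this node. -/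
inductive Split : BinTree → BinTree → BinTree → Prop
  | root (A E : BinTree) : Split (join A E) A E
  | left {L A E : BinTree} (R : BinTree) : Split L A E → Split (join L R) A (join E R)

theorem Split.numNodes_eq {T A E : BinTree} (h : Split T A E) :
    T.numNodes = A.numNodes + E.numNodes + 1 := by
  induction h with
  | root => simp only [BinaryTree.numNodes]
  | left _ _ ih => simp only [BinaryTree.numNodes]; omega

theorem split_join {L R A E : BinTree} (h : Split (join L R) A E) :
    (A = L ∧ E = R) ∨ ∃ E', E = join E' R ∧ Split L A E' := by
  cases h with
  | root => exact Or.inl ⟨rfl, rfl⟩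
  | left _ h => exact Or.inr ⟨_, rfl, h⟩

/-- A splitting of the left spine is pulled back through one rotation. At a root rotation the spine
of the source has one more node, and the splitting at the root of the target comes from the second
node of the source. -/
theorem Rotates.split {S T : BinTree} (h : Rotates S T) :
    ∀ {A' E' : BinTree}, Split T A' E' → ∃ A E, Split S A E ∧ TamariLE A A' ∧ TamariLE E E' := by
  induction h with
  | root A B C =>
    intro A' E' hs
    obtain ⟨rfl, rfl⟩ | ⟨E, rfl, hs'⟩ := split_join hs
    · exact ⟨_, _, .left _ (.root _ _), .refl, .refl⟩
    · exact ⟨_, _, .left _ (.left _ hs'), .refl, .single (.root _ _ _)⟩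
  | left R hr ih =>
    intro A' E' hs
    obtain ⟨rfl, rfl⟩ | ⟨E, rfl, hs'⟩ := split_join hs
    · exact ⟨_, _, .root _ _, .single hr, .refl⟩
    · obtain ⟨A, E, h1, h2, h3⟩ := ih hs'
      exact ⟨_, _, .left _ h1, h2, h3.join .refl⟩
  | right L hr ih =>
    intro A' E' hs
    obtain ⟨rfl, rfl⟩ | ⟨E, rfl, hs'⟩ := split_join hs
    · exact ⟨_, _, .root _ _, .refl, .single hr⟩
    · exact ⟨_, _, .left _ hs', .refl, .single (.right _ hr)⟩

theorem TamariLE.split {T A' D' : BinTree} (h : TamariLE T (BalancedTamari.join A' D')) :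
    ∃ A E, Split T A E ∧ TamariLE A A' ∧ TamariLE E D' := by
  induction h using Relation.ReflTransGen.head_induction_on with
  | refl => exact ⟨_, _, .root _ _, .refl, .refl⟩
  | head hr _ ih =>
    obtain ⟨A, E, h1, h2, h3⟩ := ih
    obtain ⟨A₁, E₁, h4, h5, h6⟩ := hr.split h1
    exact ⟨A₁, E₁, h4, h5.trans h2, h6.trans h3⟩

/-! ### The order on balanced trees -/

theorem isBalanced_join {L R : BinTree} :
    IsBalanced (join L R) ↔
      (R.height ≤ L.height + 1 ∧ L.height ≤ R.height + 1) ∧ IsBalanced L ∧ IsBalanced R := by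
  simp only [IsBalanced, Set.mem_insert_iff, Set.mem_singleton_iff]
  refine and_congr_left fun _ => ?_
  omega

/-- The order generated by the right rotations between balanced trees, described recursively. -/
inductive ConsLE : BinTree → BinTree → Prop
  | nil : ConsLE .nil .nil
  | join {L L' R R' : BinTree} : ConsLE L L' → ConsLE R R' → ConsLE (join L R) (join L' R')
  | rot {A A' B B' C C' : BinTree} : ConsLE A A' → ConsLE B B' → ConsLE C C' →
      A.height = C.height → (B.height = A.height ∨ B.height + 1 = A.height) →
      ConsLE (BalancedTamari.join (BalancedTamari.join A B) C)
        (BalancedTamari.join A' (BalancedTamari.join B' C'))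

/-- In the case `rot` both sides have height `ht A + 2`; this is the effect of the two height
conditions. -/
theorem ConsLE.height_eq {S T : BinTree} (h : ConsLE S T) : S.height = T.height := by
  induction h <;> simp only [BinaryTree.height] <;> omega

theorem ConsLE.tamariLE {S T : BinTree} (h : ConsLE S T) : TamariLE S T := by
  induction h with
  | nil => exact .refl
  | join _ _ ih₁ ih₂ => exact ih₁.join ih₂
  | rot _ _ _ _ _ ih₁ ih₂ ih₃ => exact ((ih₁.join ih₂).join ih₃).tail (.root _ _ _)

/-- If the trees above `B` have the height of `B`, then the balanced trees above `U ∧ B` are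
higher than `B`. -/
theorem height_lt_of_join_le {B : BinTree}
    (hB : ∀ B', IsBalanced B' → TamariLE B B' → B.height = B'.height) :
    ∀ {U D : BinTree}, IsBalanced D → TamariLE (join U B) D → B.height < D.height
  | U, .nil, _, h => by simpa using h.numNodes_eq
  | U, .node _ A D, hD, h => by
    obtain ⟨_, _, hD⟩ := isBalanced_join.1 hD
    obtain ⟨A₁, E, hs, -, hE⟩ := TamariLE.split h
    obtain ⟨rfl, rfl⟩ | ⟨E', rfl, hs⟩ := split_join hs
    · have := hB D hD hE
      simp only [BinaryTree.height]
      omega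
    · have := height_lt_of_join_le hB hD hE
      simp only [BinaryTree.height]
      omega

theorem Split.height_lt {T A E : BinTree} (h : Split T A E) : A.height < T.height := by
  induction h <;> simp only [BinaryTree.height] <;> omega

theorem Split.isBalanced {T A E : BinTree} (h : Split T A E) (hT : IsBalanced T) :
    IsBalanced A := by
  induction h with
  | root => exact (isBalanced_join.1 hT).2.1
  | left _ _ ih => exact ih (isBalanced_join.1 hT).2.1

theorem TamariLE.consLE_of_numNodes_le (n : ℕ) : ∀ {S T : BinTree}, S.numNodes ≤ n →
    IsBalanced S → IsBalanced T → TamariLE S T → ConsLE S T := by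
  induction n with
  | zero =>
    intro S T hn _ _ h
    have := h.numNodes_eq
    cases S <;> cases T <;> simp_all
    exact .nil
  | succ n ih =>
    intro S T hn hS hT h
    cases S with
    | nil =>
      have := h.numNodes_eq
      cases T <;> simp_all
      exact .nil
    | node u L R =>
    cases T with
    | nil => simpa using h.numNodes_eq
    | node v A' D' =>
    simp only [BinaryTree.numNodes] at hn
    obtain ⟨A, E, hs, hA, hE⟩ := TamariLE.split h
    have hsn := hs.numNodes_eq
    simp only [BinaryTree.numNodes] at hsn
    obtain ⟨hLR, hL, hR⟩ := isBalanced_join.1 hS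
    obtain ⟨hAD, hA', hD'⟩ := isBalanced_join.1 hT
    obtain ⟨rfl, rfl⟩ | ⟨B, rfl, hs'⟩ := split_join hs
    · exact .join (ih (by omega) hL hA' hA) (ih (by omega) hR hD' hE)
    have hlt : R.height < D'.height :=
      height_lt_of_join_le (fun R' hR' h => (ih (by omega) hR hR' h).height_eq) hD' hE
    have eA : A.height = A'.height := (ih (by omega) (hs'.isBalanced hL) hA' hA).height_eq
    cases hs' with
    -- `A` lies too deep: `ht A' = ht A ≤ ht L - 2 ≤ ht R - 1`, whereas `ht D' ≥ ht R + 1`, so `A' ∧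
    -- D'` would be unbalanced.
    | left R₁ hs₁ =>
      have := hs₁.height_lt
      simp only [BinaryTree.height] at hLR
      omega
    -- Here `ht R < ht D' ≤ ht A + 1` and `ht A < ht L ≤ ht R + 1` force `ht A = ht R`, hence `ht B
    -- ≤ ht A`; so `B ∧ R` is balanced and smaller.
    | root =>
      obtain ⟨hAB, hA₁, hB⟩ := isBalanced_join.1 hL
      simp only [BinaryTree.height] at hLR
      have hBR : ConsLE (BalancedTamari.join B R) D' :=
        ih (by simp only [BinaryTree.numNodes] at hn ⊢; omega)
          (isBalanced_join.2 ⟨by omega, hB, hR⟩) hD' hE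
      cases hBR with
      | join h₁ h₂ =>
        exact .rot (ih (by omega) hA₁ hA' hA) h₁ h₂ (by omega) (by omega)
      -- A further rotation at the root of `B ∧ R` would require `ht B = ht R + 1 > ht A`.
      | rot h₁ h₂ h₃ =>
        simp only [BinaryTree.height] at hAB hLR
        omega

theorem tamariLE_iff_consLE {S T : BinTree} (hS : IsBalanced S) (hT : IsBalanced T) :
    TamariLE S T ↔ ConsLE S T :=
  ⟨TamariLE.consLE_of_numNodes_le _ le_rfl hS hT, ConsLE.tamariLE⟩

/-! ### Minimal and maximal balanced trees -/

/-- The imbalance value at the root; `0` for a leaf. -/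
def tilt : BinTree → ℤ
  | .nil => 0
  | .node _ L R => (R.height : ℤ) - L.height

@[simp] theorem tilt_nil : tilt .nil = 0 := rfl

@[simp] theorem tilt_join (L R : BinTree) : tilt (join L R) = (R.height : ℤ) - L.height := rfl

theorem Rotates.height_eq {S T : BinTree} (h : Rotates S T) (hS : IsBalanced S)
    (hT : IsBalanced T) : S.height = T.height :=
  ((tamariLE_iff_consLE hS hT).1 (.single h)).height_eq

theorem isMaximalBalanced_nil : IsMaximalBalanced .nil := ⟨trivial, fun _ h => nomatch h⟩

theorem isMinimalBalanced_nil : IsMinimalBalanced .nil := ⟨trivial, fun _ h => nomatch h⟩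

/-- Rotations inside `L` or `R` that keep them balanced keep their heights, hence the balance at the
root. The rotation at the root gives a balanced tree exactly when `L` is the higher subtree and does
not lean right. -/
theorem isMaximalBalanced_join {L R : BinTree} :
    IsMaximalBalanced (join L R) ↔ (R.height ≤ L.height + 1 ∧ L.height ≤ R.height + 1) ∧
      IsMaximalBalanced L ∧ IsMaximalBalanced R ∧ (L.height = R.height + 1 → tilt L = 1) := by
  constructor
  · rintro ⟨hb, hm⟩
    obtain ⟨hh, hL, hR⟩ := isBalanced_join.1 hb
    refine ⟨hh, ⟨hL, fun S hS hbS => hm _ (.left R hS) ?_⟩,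
      ⟨hR, fun S hS hbS => hm _ (.right L hS) ?_⟩, fun he => ?_⟩
    · rw [isBalanced_join, ← hS.height_eq hL hbS]
      exact ⟨hh, hbS, hR⟩
    · rw [isBalanced_join, ← hS.height_eq hR hbS]
      exact ⟨hh, hL, hbS⟩
    · cases L with
      | nil => simp at he
      | node _ A B =>
        obtain ⟨hAB, hA, hB⟩ := isBalanced_join.1 hL
        by_contra ht
        refine hm _ (.root A B R) ?_
        simp only [tilt, BinaryTree.height] at ht he
        simp only [isBalanced_join, BinaryTree.height]
        exact ⟨by omega, hA, by omega, hB, hR⟩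
  · rintro ⟨hh, ⟨hL, hmL⟩, ⟨hR, hmR⟩, ht⟩
    refine ⟨isBalanced_join.2 ⟨hh, hL, hR⟩, fun S hS hbS => ?_⟩
    cases hS with
    | root A B =>
      simp only [isBalanced_join, BinaryTree.height, tilt] at hbS ht hh hL
      omega
    | left _ h => exact hmL _ h (isBalanced_join.1 hbS).2.1
    | right _ h => exact hmR _ h (isBalanced_join.1 hbS).2.2

theorem isMinimalBalanced_join {L R : BinTree} :
    IsMinimalBalanced (join L R) ↔ (R.height ≤ L.height + 1 ∧ L.height ≤ R.height + 1) ∧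
      IsMinimalBalanced L ∧ IsMinimalBalanced R ∧ (R.height = L.height + 1 → tilt R = -1) := by
  constructor
  · rintro ⟨hb, hm⟩
    obtain ⟨hh, hL, hR⟩ := isBalanced_join.1 hb
    refine ⟨hh, ⟨hL, fun S hS hbS => hm _ (.left R hS) ?_⟩,
      ⟨hR, fun S hS hbS => hm _ (.right L hS) ?_⟩, fun he => ?_⟩
    · rw [isBalanced_join, hS.height_eq hbS hL]
      exact ⟨hh, hbS, hR⟩
    · rw [isBalanced_join, hS.height_eq hbS hR]
      exact ⟨hh, hL, hbS⟩
    · cases R with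
      | nil => simp at he
      | node _ B C =>
        obtain ⟨hBC, hB, hC⟩ := isBalanced_join.1 hR
        by_contra ht
        refine hm _ (.root L B C) ?_
        simp only [tilt, BinaryTree.height] at ht he
        simp only [isBalanced_join, BinaryTree.height]
        exact ⟨by omega, ⟨by omega, hL, hB⟩, hC⟩
  · rintro ⟨hh, ⟨hL, hmL⟩, ⟨hR, hmR⟩, ht⟩
    refine ⟨isBalanced_join.2 ⟨hh, hL, hR⟩, fun S hS hbS => ?_⟩
    cases hS with
    | root A B C =>
      simp only [isBalanced_join, BinaryTree.height, tilt] at hbS ht hh hR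
      omega
    | left _ h => exact hmL _ h (isBalanced_join.1 hbS).2.1
    | right _ h => exact hmR _ h (isBalanced_join.1 hbS).2.2

/-! ### The recursive structure of maximal intervals -/

/-- `[S, T]` is a maximal balanced tree interval. -/
def IsMaxInterval (p : BinTree × BinTree) : Prop :=
  ConsLE p.1 p.2 ∧ IsMinimalBalanced p.1 ∧ IsMaximalBalanced p.2

theorem isMaxInterval_iff {p : BinTree × BinTree} : IsMaxInterval p ↔
    TamariLE p.1 p.2 ∧ IsMinimalBalanced p.1 ∧ IsMaximalBalanced p.2 :=
  and_congr_left fun h => (tamariLE_iff_consLE h.1.1 h.2.1).symm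

theorem isMaxInterval_nil : IsMaxInterval (.nil, .nil) :=
  ⟨.nil, isMinimalBalanced_nil, isMaximalBalanced_nil⟩

/-- The interval of trees whose roots have subtrees in the intervals `p` and `q`. -/
def graft (p q : BinTree × BinTree) : BinTree × BinTree := (join p.1 q.1, join p.2 q.2)

/-- The interval of trees in which a rotation is possible at the root, with subtrees in the
intervals `p`, `q` and `r`. -/
def rotation (p q r : BinTree × BinTree) : BinTree × BinTree :=
  (join (join p.1 q.1) r.1, join p.2 (join q.2 r.2))

theorem IsMaxInterval.graft {p q : BinTree × BinTree} (hp : IsMaxInterval p)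
    (hq : IsMaxInterval q) (h₁ : q.1.height ≤ p.1.height + 1) (h₂ : p.1.height ≤ q.1.height + 1)
    (hl : p.1.height = q.1.height + 1 → tilt p.2 = 1)
    (hr : q.1.height = p.1.height + 1 → tilt q.1 = -1) : IsMaxInterval (graft p q) := by
  have ep := hp.1.height_eq
  have eq := hq.1.height_eq
  refine ⟨.join hp.1 hq.1, isMinimalBalanced_join.2 ⟨⟨h₁, h₂⟩, hp.2.1, hq.2.1, hr⟩,
    isMaximalBalanced_join.2 ⟨⟨?_, ?_⟩, hp.2.2, hq.2.2, fun h => hl ?_⟩⟩ <;> omega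

/-- No tilt condition on the parts is needed: the heights fix the tilts at the two nodes involved,
and these satisfy the local criteria. -/
theorem IsMaxInterval.rotation {p q r : BinTree × BinTree} (hp : IsMaxInterval p)
    (hq : IsMaxInterval q) (hr : IsMaxInterval r) (h : p.1.height = r.1.height)
    (hpq : q.1.height = p.1.height ∨ q.1.height + 1 = p.1.height) :
    IsMaxInterval (rotation p q r) := by
  have ep := hp.1.height_eq
  have eq := hq.1.height_eq
  have er := hr.1.height_eq
  refine ⟨.rot hp.1 hq.1 hr.1 h hpq, ?_, ?_⟩
  · simp only [BalancedTamari.rotation, isMinimalBalanced_join, BinaryTree.height]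
    exact ⟨by omega, ⟨by omega, hp.2.1, hq.2.1, by omega⟩, hr.2.1, by omega⟩
  · simp only [BalancedTamari.rotation, isMaximalBalanced_join, BinaryTree.height]
    exact ⟨by omega, hp.2.2, ⟨by omega, hq.2.2, hr.2.2, by omega⟩, by omega⟩

theorem IsMaxInterval.cases {p : BinTree × BinTree} (hp : IsMaxInterval p) :
    p = (.nil, .nil) ∨
    (∃ q r, p = BalancedTamari.graft q r ∧ IsMaxInterval q ∧ IsMaxInterval r ∧
      (r.1.height = q.1.height ∨ (q.1.height = r.1.height + 1 ∧ tilt q.2 = 1) ∨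
        (r.1.height = q.1.height + 1 ∧ tilt r.1 = -1))) ∨
    (∃ q r s, p = BalancedTamari.rotation q r s ∧ IsMaxInterval q ∧ IsMaxInterval r ∧
      IsMaxInterval s ∧ q.1.height = s.1.height ∧
      (r.1.height = q.1.height ∨ r.1.height + 1 = q.1.height)) := by
  obtain ⟨S, T⟩ := p
  obtain ⟨hc, hS, hT⟩ := hp
  dsimp only at hc hS hT
  cases hc with
  | nil => exact .inl rfl
  | @join L L' R R' h₁ h₂ =>
    obtain ⟨hh, hL, hR, hS⟩ := isMinimalBalanced_join.1 hS
    obtain ⟨hh', hL', hR', hT⟩ := isMaximalBalanced_join.1 hT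
    have e₁ := h₁.height_eq
    have e₂ := h₂.height_eq
    refine .inr (.inl ⟨(L, L'), (R, R'), rfl, ⟨h₁, hL, hL'⟩, ⟨h₂, hR, hR'⟩, ?_⟩)
    dsimp only
    by_cases h : L.height = R.height + 1
    · exact .inr (.inl ⟨h, hT (by omega)⟩)
    by_cases h' : R.height = L.height + 1
    · exact .inr (.inr ⟨h', hS h'⟩)
    · exact .inl (by omega)
  | @rot A A' B B' C C' h₁ h₂ h₃ hh hb =>
    obtain ⟨-, hAB, hC, -⟩ := isMinimalBalanced_join.1 hS
    obtain ⟨-, hA, hB, -⟩ := isMinimalBalanced_join.1 hAB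
    obtain ⟨-, hA', hBC', -⟩ := isMaximalBalanced_join.1 hT
    obtain ⟨-, hB', hC', -⟩ := isMaximalBalanced_join.1 hBC'
    exact .inr (.inr ⟨(A, A'), (B, B'), (C, C'), rfl, ⟨h₁, hA, hA'⟩, ⟨h₂, hB, hB'⟩,
      ⟨h₃, hC, hC'⟩, hh, hb⟩)

/-! ### Maximal intervals by height -/

/-- All grafts of an element of `S` and an element of `S'`. -/
def grafts (S S' : Finset (BinTree × BinTree)) : Finset (BinTree × BinTree) :=
  (S ×ˢ S').image fun p => graft p.1 p.2

/-- All rotation intervals built on elements of `S`, `S'` and `S''`. -/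
def rotations (S S' S'' : Finset (BinTree × BinTree)) : Finset (BinTree × BinTree) :=
  (S ×ˢ S' ×ˢ S'').image fun p => rotation p.1 p.2.1 p.2.2

theorem mem_grafts {S S' : Finset (BinTree × BinTree)} {p : BinTree × BinTree} :
    p ∈ grafts S S' ↔ ∃ q r, q ∈ S ∧ r ∈ S' ∧ p = graft q r := by
  simp only [grafts, Finset.mem_image, Finset.mem_product, Prod.exists (α := BinTree × BinTree)]
  exact exists₂_congr fun _ _ =>
    ⟨fun h => ⟨h.1.1, h.1.2, h.2.symm⟩, fun h => ⟨⟨h.1, h.2.1⟩, h.2.2.symm⟩⟩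

theorem mem_rotations {S S' S'' : Finset (BinTree × BinTree)} {p : BinTree × BinTree} :
    p ∈ rotations S S' S'' ↔
      ∃ q r s, q ∈ S ∧ r ∈ S' ∧ s ∈ S'' ∧ p = rotation q r s := by
  simp only [rotations, Finset.mem_image, Finset.mem_product]
  constructor
  · rintro ⟨⟨q, r, s⟩, ⟨h₁, h₂, h₃⟩, rfl⟩
    exact ⟨q, r, s, h₁, h₂, h₃, rfl⟩
  · rintro ⟨q, r, s, h₁, h₂, h₃, rfl⟩
    exact ⟨(q, r, s), ⟨h₁, h₂, h₃⟩, rfl⟩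

/-- Finite sets of intervals of trees. -/
structure IntervalFamily where
  /-- the maximal intervals of a given height `h` -/
  all : Finset (BinTree × BinTree)
  /-- the maximal intervals of height `h - 1` -/
  lower : Finset (BinTree × BinTree)
  /-- the maximal intervals of height `h` whose greatest tree leans to the right -/
  rightTop : Finset (BinTree × BinTree)
  /-- the maximal intervals of height `h` whose least tree leans to the left -/
  leftBot : Finset (BinTree × BinTree)
  /-- the maximal intervals of height `h + 1` with a rotation at the root -/
  rot : Finset (BinTree × BinTree)

/-- The maximal intervals of trees of height `h`. -/
def intervals : ℕ → IntervalFamily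
  | 0 => ⟨{(.nil, .nil)}, ∅, ∅, ∅, ∅⟩
  | h + 1 =>
    { all := grafts (intervals h).all (intervals h).all ∪
        grafts (intervals h).rightTop (intervals h).lower ∪
        grafts (intervals h).lower (intervals h).leftBot ∪ (intervals h).rot
      lower := (intervals h).all
      rightTop := grafts (intervals h).lower (intervals h).leftBot ∪ (intervals h).rot
      leftBot := grafts (intervals h).rightTop (intervals h).lower ∪ (intervals h).rot
      rot := rotations (intervals h).all (intervals h).all (intervals h).all ∪
        rotations (intervals h).all (intervals h).lower (intervals h).all }

/-- The membership conditions of the members of `intervals h`. -/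
structure IntervalSpec (h : ℕ) : Prop where
  mem_all (p) : p ∈ (intervals h).all ↔ IsMaxInterval p ∧ p.1.height = h
  mem_lower (p) : p ∈ (intervals h).lower ↔ IsMaxInterval p ∧ p.1.height + 1 = h
  mem_rightTop (p) :
    p ∈ (intervals h).rightTop ↔ IsMaxInterval p ∧ p.1.height = h ∧ tilt p.2 = 1
  mem_leftBot (p) :
    p ∈ (intervals h).leftBot ↔ IsMaxInterval p ∧ p.1.height = h ∧ tilt p.1 = -1
  mem_rot (p) : p ∈ (intervals h).rot ↔
    IsMaxInterval p ∧ p.1.height = h + 1 ∧ tilt p.1 = -1 ∧ tilt p.2 = 1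

/-- Only a rotation at the root changes the tilt, from `-1` to `1`. The four classes are the four
disjoint pieces of `all` in `intervals`. -/
theorem IsMaxInterval.tilt_cases {p : BinTree × BinTree} (hp : IsMaxInterval p) :
    (tilt p.1 = 0 ∧ tilt p.2 = 0) ∨ (tilt p.1 = -1 ∧ tilt p.2 = -1) ∨
      (tilt p.1 = 1 ∧ tilt p.2 = 1) ∨ (tilt p.1 = -1 ∧ tilt p.2 = 1) := by
  obtain rfl | ⟨q, r, rfl, hq, hr, h⟩ | ⟨q, r, s, rfl, hq, hr, hs, h⟩ := hp.cases
  · exact .inl ⟨rfl, rfl⟩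
  · have eq := hq.1.height_eq
    have er := hr.1.height_eq
    simp only [BalancedTamari.graft, tilt_join]
    omega
  · have eq := hq.1.height_eq
    have er := hr.1.height_eq
    have es := hs.1.height_eq
    simp only [BalancedTamari.rotation, tilt_join, BinaryTree.height]
    omega

theorem IntervalSpec.mem_grafts_all {h : ℕ} (H : IntervalSpec h) (p : BinTree × BinTree) :
    p ∈ grafts (intervals h).all (intervals h).all ↔
      IsMaxInterval p ∧ p.1.height = h + 1 ∧ tilt p.1 = 0 ∧ tilt p.2 = 0 := by
  simp only [mem_grafts, H.mem_all]
  constructor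
  · rintro ⟨q, r, ⟨hq, hqh⟩, ⟨hr, hrh⟩, rfl⟩
    have eq := hq.1.height_eq
    have er := hr.1.height_eq
    refine ⟨hq.graft hr ?_ ?_ ?_ ?_, ?_⟩
    any_goals omega
    simp only [graft, tilt_join, BinaryTree.height]
    omega
  · rintro ⟨hp, hh, h₁, h₂⟩
    obtain rfl | ⟨q, r, rfl, hq, hr, h⟩ | ⟨q, r, s, rfl, hq, hr, hs, h⟩ := hp.cases
    · simp at hh
    · simp only [graft, tilt_join, BinaryTree.height] at hh h₁ h₂
      exact ⟨q, r, ⟨hq, by omega⟩, ⟨hr, by omega⟩, rfl⟩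
    · simp only [rotation, tilt_join, BinaryTree.height] at hh h₁ h₂
      omega

theorem IntervalSpec.mem_grafts_left {h : ℕ} (H : IntervalSpec h) (p : BinTree × BinTree) :
    p ∈ grafts (intervals h).rightTop (intervals h).lower ↔
      IsMaxInterval p ∧ p.1.height = h + 1 ∧ tilt p.1 = -1 ∧ tilt p.2 = -1 := by
  simp only [mem_grafts, H.mem_rightTop, H.mem_lower]
  constructor
  · rintro ⟨q, r, ⟨hq, hqh, ht⟩, ⟨hr, hrh⟩, rfl⟩
    have eq := hq.1.height_eq
    have er := hr.1.height_eq
    refine ⟨hq.graft hr ?_ ?_ (fun _ => ht) ?_, ?_⟩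
    any_goals omega
    simp only [graft, tilt_join, BinaryTree.height]
    omega
  · rintro ⟨hp, hh, h₁, h₂⟩
    obtain rfl | ⟨q, r, rfl, hq, hr, h⟩ | ⟨q, r, s, rfl, hq, hr, hs, h⟩ := hp.cases
    · simp at hh
    · simp only [graft, tilt_join, BinaryTree.height] at hh h₁ h₂
      exact ⟨q, r, ⟨hq, by omega, by omega⟩, ⟨hr, by omega⟩, rfl⟩
    · have eq := hq.1.height_eq
      have er := hr.1.height_eq
      have es := hs.1.height_eq
      simp only [rotation, tilt_join, BinaryTree.height] at hh h₁ h₂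
      omega

theorem IntervalSpec.mem_grafts_right {h : ℕ} (H : IntervalSpec h) (p : BinTree × BinTree) :
    p ∈ grafts (intervals h).lower (intervals h).leftBot ↔
      IsMaxInterval p ∧ p.1.height = h + 1 ∧ tilt p.1 = 1 ∧ tilt p.2 = 1 := by
  simp only [mem_grafts, H.mem_leftBot, H.mem_lower]
  constructor
  · rintro ⟨q, r, ⟨hq, hqh⟩, ⟨hr, hrh, ht⟩, rfl⟩
    have eq := hq.1.height_eq
    have er := hr.1.height_eq
    refine ⟨hq.graft hr ?_ ?_ ?_ (fun _ => ht), ?_⟩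
    any_goals omega
    simp only [graft, tilt_join, BinaryTree.height]
    omega
  · rintro ⟨hp, hh, h₁, h₂⟩
    obtain rfl | ⟨q, r, rfl, hq, hr, h⟩ | ⟨q, r, s, rfl, hq, hr, hs, h⟩ := hp.cases
    · simp at hh
    · simp only [graft, tilt_join, BinaryTree.height] at hh h₁ h₂
      exact ⟨q, r, ⟨hq, by omega⟩, ⟨hr, by omega, by omega⟩, rfl⟩
    · simp only [rotation, tilt_join, BinaryTree.height] at hh h₁ h₂
      omega

theorem IntervalSpec.mem_rotations {h : ℕ} (H : IntervalSpec h) (p : BinTree × BinTree) :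
    p ∈ rotations (intervals h).all (intervals h).all (intervals h).all ∪
        rotations (intervals h).all (intervals h).lower (intervals h).all ↔
      IsMaxInterval p ∧ p.1.height = h + 2 ∧ tilt p.1 = -1 ∧ tilt p.2 = 1 := by
  simp only [Finset.mem_union, BalancedTamari.mem_rotations, H.mem_all, H.mem_lower]
  constructor
  · rintro (⟨q, r, s, ⟨hq, hqh⟩, ⟨hr, hrh⟩, ⟨hs, hsh⟩, rfl⟩ |
      ⟨q, r, s, ⟨hq, hqh⟩, ⟨hr, hrh⟩, ⟨hs, hsh⟩, rfl⟩) <;>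
    · have eq := hq.1.height_eq
      have er := hr.1.height_eq
      have es := hs.1.height_eq
      refine ⟨hq.rotation hr hs (by omega) (by omega), ?_⟩
      simp only [rotation, tilt_join, BinaryTree.height]
      omega
  · rintro ⟨hp, hh, h₁, h₂⟩
    obtain rfl | ⟨q, r, rfl, hq, hr, h⟩ | ⟨q, r, s, rfl, hq, hr, hs, h, h'⟩ := hp.cases
    · simp at hh
    · have eq := hq.1.height_eq
      have er := hr.1.height_eq
      simp only [graft, tilt_join, BinaryTree.height] at hh h₁ h₂
      omega
    · simp only [rotation, tilt_join, BinaryTree.height] at hh h₁ h₂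
      obtain h' | h' := h'
      · exact .inl ⟨q, r, s, ⟨hq, by omega⟩, ⟨hr, by omega⟩, ⟨hs, by omega⟩, rfl⟩
      · exact .inr ⟨q, r, s, ⟨hq, by omega⟩, ⟨hr, by omega⟩, ⟨hs, by omega⟩, rfl⟩

theorem isMaxInterval_height_zero {p : BinTree × BinTree} :
    IsMaxInterval p ∧ p.1.height = 0 ↔ p = (.nil, .nil) := by
  constructor
  · rintro ⟨hp, hh⟩
    obtain rfl | ⟨q, r, rfl, _⟩ | ⟨q, r, s, rfl, _⟩ := hp.cases
    · rfl
    · simp [graft] at hh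
    · simp [rotation] at hh
  · rintro rfl
    exact ⟨isMaxInterval_nil, rfl⟩

theorem intervalSpec (h : ℕ) : IntervalSpec h := by
  induction h with
  | zero =>
    constructor <;> intro p
    · rw [isMaxInterval_height_zero]
      exact Finset.mem_singleton
    · simp [intervals]
    · rw [← and_assoc, isMaxInterval_height_zero]
      refine iff_of_false (Finset.notMem_empty _) ?_
      rintro ⟨rfl, h⟩
      simp at h
    · rw [← and_assoc, isMaxInterval_height_zero]
      refine iff_of_false (Finset.notMem_empty _) ?_
      rintro ⟨rfl, h⟩
      simp at h
    -- A graft has equal tilts at both ends because heights are constant, and a rotation has height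
    -- at least `2`.
    · refine iff_of_false (Finset.notMem_empty _) ?_
      rintro ⟨hp, hh, h₁, h₂⟩
      obtain rfl | ⟨q, r, rfl, hq, hr, h⟩ | ⟨q, r, s, rfl, hq, hr, hs, h⟩ := hp.cases
      · simp at hh
      · have eq := hq.1.height_eq
        have er := hr.1.height_eq
        simp only [graft, tilt_join, BinaryTree.height] at hh h₁ h₂
        omega
      · simp [rotation] at hh
  | succ h H =>
    constructor <;> intro p
    · simp only [intervals, Finset.mem_union, H.mem_grafts_all, H.mem_grafts_left,
        H.mem_grafts_right, H.mem_rot]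
      constructor
      · rintro (((h | h) | h) | h) <;> exact ⟨h.1, h.2.1⟩
      · rintro ⟨hp, hh⟩
        have := hp.tilt_cases
        tauto
    · simp [intervals, H.mem_all]
    · simp only [intervals, Finset.mem_union, H.mem_grafts_right, H.mem_rot]
      constructor
      · rintro (h | h) <;> exact ⟨h.1, h.2.1, h.2.2.2⟩
      · rintro ⟨hp, hh, ht⟩
        have := hp.tilt_cases
        simp only [ht] at this
        norm_num at this
        tauto
    · simp only [intervals, Finset.mem_union, H.mem_grafts_left, H.mem_rot]
      constructor
      · rintro (h | h) <;> exact ⟨h.1, h.2.1, h.2.2.1⟩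
      · rintro ⟨hp, hh, ht⟩
        have := hp.tilt_cases
        simp only [ht] at this
        norm_num at this
        tauto
    · exact H.mem_rotations p

/-! ### Generating series -/

/-- The generating series of a finite set of intervals according to the number of leaves. -/
noncomputable def genSeries (S : Finset (BinTree × BinTree)) : PowerSeries ℤ :=
  ∑ p ∈ S, PowerSeries.X ^ p.1.numLeaves

theorem coeff_genSeries (n : ℕ) (S : Finset (BinTree × BinTree)) :
    PowerSeries.coeff n (genSeries S) = ((S.filter fun p => p.1.numLeaves = n).card : ℤ) := by
  simp [genSeries, PowerSeries.coeff_X_pow, Finset.sum_boole, eq_comm]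

theorem genSeries_union {S S' : Finset (BinTree × BinTree)} (h : Disjoint S S') :
    genSeries (S ∪ S') = genSeries S + genSeries S' := Finset.sum_union h

theorem genSeries_grafts (S S' : Finset (BinTree × BinTree)) :
    genSeries (grafts S S') = genSeries S * genSeries S' := by
  rw [genSeries, grafts, Finset.sum_image, Finset.sum_product, genSeries, genSeries,
    Finset.sum_mul_sum]
  · simp [graft, pow_add]
  · rintro ⟨⟨_, _⟩, ⟨_, _⟩⟩ _ ⟨⟨_, _⟩, ⟨_, _⟩⟩ _ h
    simp only [graft, Prod.mk.injEq, BinaryTree.node.injEq, true_and] at h ⊢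
    tauto

theorem genSeries_rotations (S S' S'' : Finset (BinTree × BinTree)) :
    genSeries (rotations S S' S'') = genSeries S * genSeries S' * genSeries S'' := by
  rw [genSeries, rotations, Finset.sum_image, Finset.sum_product, mul_assoc, genSeries, genSeries,
    genSeries, Finset.sum_mul_sum, Finset.sum_mul]
  · refine Finset.sum_congr rfl fun p _ => ?_
    simp [Finset.sum_product, Finset.mul_sum, rotation, pow_add, mul_assoc]
  · rintro ⟨⟨_, _⟩, ⟨_, _⟩, ⟨_, _⟩⟩ _ ⟨⟨_, _⟩, ⟨_, _⟩, ⟨_, _⟩⟩ _ h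
    simp only [rotation, Prod.mk.injEq, BinaryTree.node.injEq, true_and] at h ⊢
    tauto

theorem genSeries_all_succ (h : ℕ) :
    genSeries (intervals (h + 1)).all = genSeries (intervals h).all ^ 2 +
      genSeries (intervals h).rightTop * genSeries (intervals h).lower +
      genSeries (intervals h).lower * genSeries (intervals h).leftBot +
      genSeries (intervals h).rot := by
  have H := intervalSpec h
  rw [intervals, genSeries_union, genSeries_union, genSeries_union, genSeries_grafts,
    genSeries_grafts, genSeries_grafts, sq]
  · rw [Finset.disjoint_left]
    simp only [H.mem_grafts_all, H.mem_grafts_left]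
    rintro p ⟨_, _, h, _⟩ ⟨_, _, h', _⟩
    omega
  · rw [Finset.disjoint_left]
    simp only [Finset.mem_union, H.mem_grafts_all, H.mem_grafts_left, H.mem_grafts_right]
    rintro p (⟨_, _, h, _⟩ | ⟨_, _, h, _⟩) ⟨_, _, h', _⟩ <;> omega
  · rw [Finset.disjoint_left]
    simp only [Finset.mem_union, H.mem_grafts_all, H.mem_grafts_left, H.mem_grafts_right,
      H.mem_rot]
    rintro p ((⟨_, _, h, i⟩ | ⟨_, _, h, i⟩) | ⟨_, _, h, i⟩) ⟨_, _, h', i'⟩ <;> omega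

theorem genSeries_rightTop_succ (h : ℕ) :
    genSeries (intervals (h + 1)).rightTop =
      genSeries (intervals h).lower * genSeries (intervals h).leftBot +
        genSeries (intervals h).rot := by
  have H := intervalSpec h
  rw [intervals, genSeries_union, genSeries_grafts]
  rw [Finset.disjoint_left]
  simp only [H.mem_grafts_right, H.mem_rot]
  rintro p ⟨_, _, h, i⟩ ⟨_, _, h', i'⟩
  omega

theorem genSeries_leftBot_succ (h : ℕ) :
    genSeries (intervals (h + 1)).leftBot =
      genSeries (intervals h).rightTop * genSeries (intervals h).lower +
        genSeries (intervals h).rot := by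
  have H := intervalSpec h
  rw [intervals, genSeries_union, genSeries_grafts]
  rw [Finset.disjoint_left]
  simp only [H.mem_grafts_left, H.mem_rot]
  rintro p ⟨_, _, h, i⟩ ⟨_, _, h', i'⟩
  omega

theorem genSeries_rot_succ (h : ℕ) :
    genSeries (intervals (h + 1)).rot = genSeries (intervals h).all ^ 3 +
      genSeries (intervals h).all ^ 2 * genSeries (intervals h).lower := by
  have H := intervalSpec h
  rw [intervals, genSeries_union, genSeries_rotations, genSeries_rotations]
  · ring
  rw [Finset.disjoint_left]
  simp only [mem_rotations, H.mem_all, H.mem_lower]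
  rintro _ ⟨q, r, s, hq, hr, hs, rfl⟩ ⟨q', r', s', hq', hr', hs', e⟩
  simp only [rotation, Prod.mk.injEq, BinaryTree.node.injEq, true_and] at e
  -- The middle parts would have both height `h` and height `h - 1`.
  rw [e.1.1.2] at hr
  omega

/-- Left-right reflection is why one variable `z` serves both families, with the coefficient `2` in
`2yz`. -/
theorem genSeries_leftBot_eq (h : ℕ) :
    genSeries (intervals h).leftBot = genSeries (intervals h).rightTop := by
  induction h with
  | zero => rfl
  | succ h ih => rw [genSeries_leftBot_succ, genSeries_rightTop_succ, ih, mul_comm]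

/-- The generating series of the sets of intervals of a given height. -/
noncomputable def heightSeries (h : ℕ) : Fin 4 → PowerSeries ℤ :=
  ![genSeries (intervals h).all, genSeries (intervals h).lower,
    genSeries (intervals h).rightTop, genSeries (intervals h).rot]

theorem heightSeries_zero : heightSeries 0 = ![PowerSeries.X, 0, 0, 0] := by
  simp [heightSeries, intervals, genSeries]

theorem heightSeries_succ (h : ℕ) :
    heightSeries (h + 1) = fun j => MvPolynomial.aeval (heightSeries h) (growth j) := by
  funext j
  fin_cases j
  · simp [heightSeries, growth, genSeries_all_succ, genSeries_leftBot_eq]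
    ring
  · simp [heightSeries, growth, intervals]
  · simp [heightSeries, growth, genSeries_rightTop_succ, genSeries_leftBot_eq]
  · simp [heightSeries, growth, genSeries_rot_succ]

/-- Each unfolding of `iterates` contributes the `x`-component at the current height and moves on to
the next height. -/
theorem aeval_heightSeries_iterates (i h : ℕ) :
    MvPolynomial.aeval (heightSeries h) (iterates i) =
      ∑ j ∈ Finset.range (i + 1), genSeries (intervals (h + j)).all := by
  induction i generalizing h with
  | zero => simp [iterates, heightSeries]
  | succ i ih =>
    rw [iterates, map_add, MvPolynomial.aeval_X, MvPolynomial.aeval_bind₁, ← heightSeries_succ,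
      ih, Finset.sum_range_succ' _ (i + 1), add_comm]
    simp only [heightSeries, Matrix.cons_val_zero, add_zero, add_assoc, add_comm 1]

/-! ### Counting maximal intervals -/

theorem numLeaves_eq_of_tamariLE {S T : BinTree} (h : TamariLE S T) :
    S.numLeaves = T.numLeaves := by
  rw [BinaryTree.numLeaves_eq_numNodes_succ, BinaryTree.numLeaves_eq_numNodes_succ, h.numNodes_eq]

theorem maximalBalancedIntervals_eq {n N : ℕ} (hN : n ≤ N) :
    maximalBalancedIntervals n = (((Finset.range (N + 1)).biUnion
      fun h => (intervals h).all.filter fun p => p.1.numLeaves = n :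
        Finset (BinTree × BinTree)) : Set (BinTree × BinTree)) := by
  ext p
  simp only [maximalBalancedIntervals, Set.mem_ofPred_eq, Finset.mem_coe, Finset.mem_biUnion,
    Finset.mem_filter, (intervalSpec _).mem_all, isMaxInterval_iff, Finset.mem_range]
  constructor
  · rintro ⟨h₁, -, h⟩
    -- A tree with `n` leaves has height less than `n`, so the heights up to `N` suffice.
    have := p.1.height_le_numNodes
    rw [BinaryTree.numLeaves_eq_numNodes_succ] at h₁
    exact ⟨p.1.height, by omega, ⟨h, rfl⟩, by rwa [BinaryTree.numLeaves_eq_numNodes_succ]⟩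
  · rintro ⟨_, _, ⟨h, _⟩, h₁⟩
    exact ⟨h₁, (numLeaves_eq_of_tamariLE h.1).symm.trans h₁, h⟩

theorem finite_maximalBalancedIntervals (n : ℕ) : (maximalBalancedIntervals n).Finite := by
  rw [maximalBalancedIntervals_eq le_rfl]
  exact Finset.finite_toSet _

theorem coeff_maximalIntervalSeries {n N : ℕ} (hN : n ≤ N) :
    PowerSeries.coeff n maximalIntervalSeries = PowerSeries.coeff n
      (MvPolynomial.aeval (![PowerSeries.X, 0, 0, 0] : Fin 4 → PowerSeries ℤ) (iterates N)) := by
  rw [← heightSeries_zero, aeval_heightSeries_iterates, maximalIntervalSeries,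
    PowerSeries.coeff_mk, maximalBalancedIntervals_eq hN, Set.ncard_coe_finset,
    Finset.card_biUnion, map_sum]
  · simp only [coeff_genSeries, zero_add, Nat.cast_sum]
  · intro h _ h' _ hh
    rw [Function.onFun, Finset.disjoint_left]
    simp only [Finset.mem_filter, (intervalSpec _).mem_all]
    rintro p ⟨⟨_, e⟩, _⟩ ⟨⟨_, e'⟩, _⟩
    exact hh (e.symm.trans e')

/-! ### Weighted orders and substitution -/

section WeightedOrder

open MvPowerSeries

theorem weightedOrder_le_weightedOrder_subst {σ τ R : Type*} [CommRing R]
    (w : σ → ℕ) (w' : τ → ℕ) {a : σ → MvPowerSeries τ R} (ha : HasSubst a)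
    (h : ∀ i, (w i : ℕ∞) ≤ (a i).weightedOrder w') (f : MvPowerSeries σ R) :
    f.weightedOrder w ≤ (f.subst a).weightedOrder w' := by
  refine le_trans (le_iInf₂ fun d hd => ?_) (le_weightedOrder_subst w' ha f)
  refine (weightedOrder_le w hd).trans ?_
  simp only [Finsupp.weight_apply, Finsupp.sum, Nat.cast_sum, nsmul_eq_mul, smul_eq_mul,
    Nat.cast_mul, Function.comp_apply]
  exact Finset.sum_le_sum fun i _ => by gcongr; exact h i

theorem weightedOrder_add_one_le_weightedOrder_subst {σ τ R : Type*} [CommRing R]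
    (w : σ → ℕ) (w' : τ → ℕ) {a : σ → MvPowerSeries τ R} (ha : HasSubst a)
    (h : ∀ i, (w i : ℕ∞) + 1 ≤ (a i).weightedOrder w') {f : MvPowerSeries σ R}
    (hf : constantCoeff f = 0) :
    f.weightedOrder w + 1 ≤ (f.subst a).weightedOrder w' := by
  refine le_trans (le_iInf₂ fun d hd => ?_) (le_weightedOrder_subst w' ha f)
  have hd0 : d ≠ 0 := by
    rintro rfl
    exact hd hf
  obtain ⟨i, hi⟩ := Finsupp.support_nonempty_iff.2 hd0
  refine (add_le_add_left (weightedOrder_le w hd) 1).trans ?_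
  -- Each factor of the monomial gains one unit of order, and a nonconstant monomial has at least
  -- one factor.
  have h1 : (1 : ℕ∞) ≤ ∑ i ∈ d.support, (d i : ℕ∞) := by
    have : 1 ≤ ∑ i ∈ d.support, d i :=
      (Nat.one_le_iff_ne_zero.2 (Finsupp.mem_support_iff.1 hi)).trans
        (Finset.single_le_sum (fun _ _ => Nat.zero_le _) hi)
    exact_mod_cast this
  refine (add_le_add_right h1 _).trans ?_
  simp only [Finsupp.weight_apply, Finsupp.sum, Nat.cast_sum, nsmul_eq_mul, smul_eq_mul,
    Nat.cast_mul, Function.comp_apply]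
  rw [← Finset.sum_add_distrib]
  refine Finset.sum_le_sum fun i _ => ?_
  rw [← mul_add_one]
  gcongr
  exact h i

end WeightedOrder

/-! ### The functional equation -/

open MvPowerSeries

/-- Weights of the variables for which the substitution of `growth` raises the order. -/
def growthWeight : Fin 4 → ℕ := ![2, 1, 2, 3]

/-- Total degree would not grow, since `y ↦ x` and `x ↦ ⋯ + t` contain linear terms. These ask for
weights increasing along `y`, `x`, `t`; with the values `1`, `2`, `3`, the term `yz` in the image of
`x` asks for weight at least `2` on `z`, and `z ↦ ⋯ + t` for at most `2`. -/
theorem succ_growthWeight_le (j : Fin 4) :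
    (growthWeight j : ℕ∞) + 1 ≤
      (growth j : MvPowerSeries (Fin 4) ℤ).weightedOrder growthWeight := by
  have hX (i : Fin 4) : (growthWeight i : ℕ∞) ≤
      (X i : MvPowerSeries (Fin 4) ℤ).weightedOrder growthWeight := by
    rw [X, weightedOrder_monomial_of_ne_zero _ one_ne_zero, Finsupp.weight_single, one_smul]
  have hmul {f g : MvPowerSeries (Fin 4) ℤ} {a b : ℕ∞} (hf : a ≤ f.weightedOrder growthWeight)
      (hg : b ≤ g.weightedOrder growthWeight) : a + b ≤ (f * g).weightedOrder growthWeight :=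
    (add_le_add hf hg).trans (le_weightedOrder_mul _)
  have hadd {f g : MvPowerSeries (Fin 4) ℤ} {a : ℕ∞} (hf : a ≤ f.weightedOrder growthWeight)
      (hg : a ≤ g.weightedOrder growthWeight) : a ≤ (f + g).weightedOrder growthWeight :=
    (le_min hf hg).trans (min_weightedOrder_le_add _)
  have h0 : (2 : ℕ∞) ≤ (X 0 : MvPowerSeries (Fin 4) ℤ).weightedOrder growthWeight := hX 0
  have h1 : (1 : ℕ∞) ≤ (X 1 : MvPowerSeries (Fin 4) ℤ).weightedOrder growthWeight := hX 1
  have h2 : (2 : ℕ∞) ≤ (X 2 : MvPowerSeries (Fin 4) ℤ).weightedOrder growthWeight := hX 2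
  have h3 : (3 : ℕ∞) ≤ (X 3 : MvPowerSeries (Fin 4) ℤ).weightedOrder growthWeight := hX 3
  have h12 := hmul h1 h2
  have h00 := hmul h0 h0
  norm_num at h12 h00
  fin_cases j
  · have : (growth 0 : MvPowerSeries (Fin 4) ℤ) = X 0 * X 0 + (X 1 * X 2 + X 1 * X 2) + X 3 := by
      simp only [growth, Matrix.cons_val_zero, two_mul, add_mul]
      simp [sq]
    simp only [Fin.zero_eta, this]
    refine hadd (hadd (le_trans ?_ h00) (hadd (le_trans ?_ h12) (le_trans ?_ h12)))
      (le_trans ?_ h3) <;> norm_num [growthWeight]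
  · have : (growth 1 : MvPowerSeries (Fin 4) ℤ) = X 0 := by simp [growth]
    simp only [Fin.mk_one, this]
    refine le_trans ?_ h0
    norm_num [growthWeight]
  · have : (growth 2 : MvPowerSeries (Fin 4) ℤ) = X 1 * X 2 + X 3 := by simp [growth]
    simp only [Fin.reduceFinMk, this]
    change ((2 : ℕ) : ℕ∞) + 1 ≤ _
    refine hadd (le_trans ?_ h12) (le_trans ?_ h3) <;> norm_num
  · have : (growth 3 : MvPowerSeries (Fin 4) ℤ) = X 0 * X 0 * X 0 + X 0 * X 0 * X 1 := by
      simp [growth]; ring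
    simp only [Fin.reduceFinMk, this]
    change ((3 : ℕ) : ℕ∞) + 1 ≤ _
    refine hadd (le_trans ?_ (hmul h00 h0)) (le_trans ?_ (hmul h00 h1)) <;> norm_num

theorem weightedOrder_subst_growth {f : MvPowerSeries (Fin 4) ℤ} (hf : constantCoeff f = 0) :
    f.weightedOrder growthWeight + 1 ≤
      (f.subst fun j => (growth j : MvPowerSeries (Fin 4) ℤ)).weightedOrder growthWeight :=
  weightedOrder_add_one_le_weightedOrder_subst _ _ hasSubst_growth succ_growthWeight_le hf

theorem constantCoeff_subst_growth {f : MvPowerSeries (Fin 4) ℤ} (hf : constantCoeff f = 0) :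
    constantCoeff (f.subst fun j => (growth j : MvPowerSeries (Fin 4) ℤ)) = 0 := by
  refine constantCoeff_subst_eq_zero hasSubst_growth (fun j => ?_) hf
  fin_cases j <;> simp [growth]

theorem subst_growth_coe (p : MvPolynomial (Fin 4) ℤ) :
    (p : MvPowerSeries (Fin 4) ℤ).subst (fun j => (growth j : MvPowerSeries (Fin 4) ℤ)) =
      (MvPolynomial.bind₁ growth p : MvPolynomial (Fin 4) ℤ) := by
  rw [subst_coe]
  have : (MvPolynomial.aeval fun j => (growth j : MvPowerSeries (Fin 4) ℤ)) =
      (MvPolynomial.coeToMvPowerSeries.algHom (R := ℤ) ℤ).comp (MvPolynomial.bind₁ growth) := by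
    ext j
    simp
  rw [this]
  simp

theorem iterates_succ (i : ℕ) : (iterates (i + 1) : MvPowerSeries (Fin 4) ℤ) =
    X 0 + (iterates i : MvPowerSeries (Fin 4) ℤ).subst
      (fun j => (growth j : MvPowerSeries (Fin 4) ℤ)) := by
  rw [subst_growth_coe, iterates]
  simp

theorem constantCoeff_iterates (i : ℕ) :
    constantCoeff (iterates i : MvPowerSeries (Fin 4) ℤ) = 0 := by
  induction i with
  | zero => simp [iterates]
  | succ i ih =>
    rw [iterates_succ, map_add, constantCoeff_subst_growth ih, constantCoeff_X, add_zero]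

theorem one_le_weightedOrder {σ : Type*} {w : σ → ℕ} (hw : ∀ i, w i ≠ 0)
    {f : MvPowerSeries σ ℤ} (hf : constantCoeff f = 0) : 1 ≤ f.weightedOrder w := by
  refine le_weightedOrder w fun d hd => ?_
  have : Finsupp.weight w d = 0 := by
    rw [← Nat.lt_one_iff]; exact_mod_cast hd
  have h0 : d = 0 := by
    ext i
    have := Finsupp.le_weight w (hw i) d
    rwa [‹Finsupp.weight w d = 0›, Nat.le_zero] at this
  rw [h0]
  exact hf

/-- Consecutive differences are obtained from one another by the substitution, so each has order at
least one more than the bound for the previous one. -/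
theorem weightedOrder_iterates_sub (i : ℕ) : ((i + 1 : ℕ) : ℕ∞) ≤
    (iterates (i + 1) - iterates i : MvPowerSeries (Fin 4) ℤ).weightedOrder growthWeight := by
  have hw : ∀ i, growthWeight i ≠ 0 := by decide
  induction i with
  | zero =>
    refine one_le_weightedOrder hw ?_
    rw [map_sub, constantCoeff_iterates, constantCoeff_iterates, sub_zero]
  | succ i ih =>
    rw [iterates_succ (i + 1)]
    nth_rw 2 [iterates_succ i]
    rw [add_sub_add_left_eq_sub, ← subst_sub hasSubst_growth]
    refine le_trans ?_ (weightedOrder_subst_growth ?_)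
    · rw [Nat.cast_succ]
      gcongr
    · rw [map_sub, constantCoeff_iterates, constantCoeff_iterates, sub_zero]

/-- The coefficientwise limit of the iterates. -/
noncomputable def limitSeries : MvPowerSeries (Fin 4) ℤ :=
  fun d => MvPolynomial.coeff d (iterates (Finsupp.weight growthWeight d))

theorem coeff_iterates_eq {d : Fin 4 →₀ ℕ} {i : ℕ} (hi : Finsupp.weight growthWeight d ≤ i) :
    MvPolynomial.coeff d (iterates i) = coeff d limitSeries := by
  induction i, hi using Nat.le_induction with
  | base => rfl
  | succ i hi ih =>
    rw [← ih, ← sub_eq_zero, ← MvPolynomial.coeff_coe, ← MvPolynomial.coeff_coe, ← map_sub]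
    refine coeff_eq_zero_of_lt_weightedOrder growthWeight
      (lt_of_lt_of_le ?_ (weightedOrder_iterates_sub i))
    exact_mod_cast Nat.lt_succ_of_le hi

theorem weightedOrder_limitSeries_sub (i : ℕ) : ((i + 1 : ℕ) : ℕ∞) ≤
    (limitSeries - iterates i : MvPowerSeries (Fin 4) ℤ).weightedOrder growthWeight := by
  refine nat_le_weightedOrder _ fun d hd => ?_
  rw [map_sub, MvPolynomial.coeff_coe, coeff_iterates_eq (Nat.le_of_lt_succ hd), sub_self]

theorem constantCoeff_limitSeries : constantCoeff limitSeries = 0 := by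
  rw [← coeff_zero_eq_constantCoeff_apply, ← coeff_iterates_eq (i := 0) (by simp),
    ← MvPolynomial.coeff_coe, coeff_zero_eq_constantCoeff_apply, constantCoeff_iterates]

theorem eq_zero_of_forall_le_weightedOrder {σ : Type*} (w : σ → ℕ) {f : MvPowerSeries σ ℤ}
    (h : ∀ i : ℕ, (i : ℕ∞) ≤ f.weightedOrder w) : f = 0 := by
  rw [← weightedOrder_eq_top_iff w]
  exact ENat.eq_top_iff_forall_ge.2 h

theorem isSolution_limitSeries : IsSolution limitSeries := by
  refine ⟨constantCoeff_limitSeries, ?_⟩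
  rw [← sub_eq_zero]
  refine eq_zero_of_forall_le_weightedOrder growthWeight fun i => ?_
  -- Compare with the exact relation between `iterates (i + 1)` and `iterates i`: both error terms
  -- have order at least `i`.
  have e : limitSeries - (X 0 + limitSeries.subst fun j => (growth j : MvPowerSeries (Fin 4) ℤ)) =
      (limitSeries - (iterates (i + 1) : MvPowerSeries (Fin 4) ℤ)) +
      -((limitSeries - iterates i : MvPowerSeries (Fin 4) ℤ).subst
        fun j => (growth j : MvPowerSeries (Fin 4) ℤ)) := by
    rw [subst_sub hasSubst_growth, iterates_succ]
    ring
  rw [e]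
  refine (le_min ?_ ?_).trans (min_weightedOrder_le_add _)
  · refine le_trans ?_ (weightedOrder_limitSeries_sub (i + 1))
    exact_mod_cast (by omega)
  · rw [weightedOrder_neg]
    refine le_trans ?_ ((weightedOrder_limitSeries_sub i).trans (le_self_add.trans
      (weightedOrder_subst_growth ?_)))
    · exact_mod_cast (by omega)
    · rw [map_sub, constantCoeff_limitSeries, constantCoeff_iterates, sub_zero]

theorem IsSolution.unique {A B : MvPowerSeries (Fin 4) ℤ} (hA : IsSolution A)
    (hB : IsSolution B) : A = B := by
  rw [← sub_eq_zero]
  have hc : constantCoeff (A - B) = 0 := by rw [map_sub, hA.1, hB.1, sub_zero]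
  -- The difference is fixed by a substitution that raises its order, so its order is infinite.
  have e : A - B = (A - B).subst fun j => (growth j : MvPowerSeries (Fin 4) ℤ) := by
    rw [subst_sub hasSubst_growth]
    nth_rw 1 [hA.2, hB.2]
    ring
  refine eq_zero_of_forall_le_weightedOrder growthWeight fun i => ?_
  induction i with
  | zero => simp
  | succ i ih =>
    rw [e]
    refine le_trans ?_ (weightedOrder_subst_growth hc)
    rw [Nat.cast_succ]
    gcongr

theorem coeff_restrictX_limitSeries (n : ℕ) :
    PowerSeries.coeff n (restrictX limitSeries) = PowerSeries.coeff n
      (MvPolynomial.aeval (![PowerSeries.X, 0, 0, 0] : Fin 4 → PowerSeries ℤ)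
        (iterates (2 * n))) := by
  rw [← subst_coe, restrictX, ← sub_eq_zero, ← map_sub, ← subst_sub hasSubst_restrictX]
  -- Giving the remaining variable the weight `2` of `x` places its `n`-th power in weight `2 * n`,
  -- where `iterates (2 * n)` already agrees with the limit.
  refine coeff_eq_zero_of_lt_weightedOrder (fun _ => 2) (lt_of_lt_of_le ?_
    (weightedOrder_le_weightedOrder_subst growthWeight _ hasSubst_restrictX (fun j => ?_) _))
  · refine lt_of_lt_of_le ?_ (weightedOrder_limitSeries_sub _)
    rw [Finsupp.weight_single]
    norm_cast
    simp
    omega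
  · fin_cases j
    · simp [growthWeight, PowerSeries.X, X, weightedOrder_monomial_of_ne_zero,
        Finsupp.weight_single]
    all_goals simp

end BalancedTamari

theorem mainTheorem6 :
    ∃ A : MvPowerSeries (Fin 4) ℤ,
      BalancedTamari.IsSolution A ∧
      (∀ B : MvPowerSeries (Fin 4) ℤ, BalancedTamari.IsSolution B → B = A) ∧
      (∀ d : Fin 4 →₀ ℕ, ∃ N : ℕ, ∀ i : ℕ, N ≤ i →
        MvPolynomial.coeff d (BalancedTamari.iterates i) = MvPowerSeries.coeff d A) ∧
      (∀ n : ℕ, (BalancedTamari.maximalBalancedIntervals n).Finite) ∧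
      BalancedTamari.maximalIntervalSeries = BalancedTamari.restrictX A := by
  refine ⟨BalancedTamari.limitSeries, BalancedTamari.isSolution_limitSeries,
    fun B hB => hB.unique BalancedTamari.isSolution_limitSeries,
    fun d => ⟨_, fun i hi => BalancedTamari.coeff_iterates_eq hi⟩,
    BalancedTamari.finite_maximalBalancedIntervals, PowerSeries.ext fun n => ?_⟩
  rw [BalancedTamari.coeff_restrictX_limitSeries,
    BalancedTamari.coeff_maximalIntervalSeries (N := 2 * n) (by omega)]
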